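/- Let $p$ be an odd prime, $F$ a field of characteristic $p$, and $L=\bigoplus_{i\ge 1}L_i$ an infinite-dimensional graded Lie algebra of maximal class over $F$: that is, $\dim L_1=2$, $\dim L_i\le 1$ for $i\ge 2$, and $[L_i,L_1]=L_{i+1}$ for all $i\ge 1$. For $i\ge 2$ let $C_i=\{a\in L_1 : [L_i,a]=0\}$ be the two-step centralizers of $L$. Let $n_1<n_2<\cdots$ be the indices $n\ge 2$ with $C_n\ne C_2$; the constituents of $L$ are the segments $C_2,\dots,C_{n_1}$ and $C_{n_j+1},\dots,C_{n_{j+1}}$ for $j\ge1$, and the sequence of constituent lengths is $n_1,\ n_2-n_1,\ n_3-n_2,\dots$ (so the first constituent has, by convention, length $n_1$). Let $q=p^h$ and $r=p^k$ with $k\ge 1$, and let $0\le\beta<h$. Suppose that the sequence of constituent lengths of $L$ begins with the $r$ terms $$2q,\ \underbrace{q,\dots,q}_{r-2},\ 2q-p^\beta ,$$ and that the corresponding initial segment $C_2,C_3,\dots,C_{n_r}$ of the sequence of two-step centralizers involves only the first two two-step centralizers in order of occurrence, i.e. $C_i\in\{C_2,C_{2q}\}$ for $2\le i\le n_r$. Then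 $L$ has exactly two distinct two-step centralizers (the set $\{C_i : i\ge 2\}$ has two elements), $L$ has infinitely many constituents, and its whole sequence of constituent lengths is an infinite concatenation of blocks, each of which is one of the two patterns $$2q,\ \underbrace{q,\dots,q}_{r-2}\qquad\text{or}\qquad 2q-p^\beta,\ \underbrace{q,\dots,q}_{r-2}.$$ -/

import Mathlib

namespace MaxClass

variable {F L : Type*} [Field F] [LieRing L] [LieAlgebra F L]

/-- The family `𝒜` of subspaces makes the Lie algebra `L` over the field `F` a graded algebra of
maximal class: `L = ⨁_{i ≥ 1} 𝒜 i`, with `𝒜 1` of dimension `2`, every `𝒜 i` with `i ≥ 2` of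
dimension at most `1`, and `[𝒜 i, 𝒜 1] = 𝒜 (i + 1)` for every `i ≥ 1`. -/
structure IsMaximalClass (𝒜 : ℕ → Submodule F L) : Prop where
  isInternal : DirectSum.IsInternal 𝒜
  zero_eq_bot : 𝒜 0 = ⊥
  lie_mem : ∀ i j : ℕ, ∀ a ∈ 𝒜 i, ∀ b ∈ 𝒜 j, ⁅a, b⁆ ∈ 𝒜 (i + j)
  rank_one : Module.rank F (𝒜 1) = 2
  rank_le_one : ∀ i : ℕ, 2 ≤ i → Module.rank F (𝒜 i) ≤ 1
  span_lie : ∀ i : ℕ, 1 ≤ i →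
    Submodule.span F {c : L | ∃ a ∈ 𝒜 i, ∃ b ∈ 𝒜 1, ⁅a, b⁆ = c} = 𝒜 (i + 1)

/-- The two-step centralizer `C_i = C_{L_1}(L_i)`; it is meant for `i ≥ 2`. -/
def twoStepCentralizer (𝒜 : ℕ → Submodule F L) (i : ℕ) : Submodule F L where
  carrier := {a | a ∈ 𝒜 1 ∧ ∀ b ∈ 𝒜 i, ⁅b, a⁆ = 0}
  zero_mem' := ⟨Submodule.zero_mem _, fun b _ => lie_zero b⟩
  add_mem' := fun {a a'} ha ha' =>
    ⟨Submodule.add_mem _ ha.1 ha'.1, fun b hb => by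
      rw [lie_add, ha.2 b hb, ha'.2 b hb, add_zero]⟩
  smul_mem' := fun t a ha =>
    ⟨Submodule.smul_mem _ t ha.1, fun b hb => by rw [lie_smul, ha.2 b hb, smul_zero]⟩

/-- A constituent ends in weight `n` when `C_n` differs from the first two-step centralizer
`C_2`. -/
def IsConstituentEnd (𝒜 : ℕ → Submodule F L) (n : ℕ) : Prop :=
  2 ≤ n ∧ twoStepCentralizer 𝒜 n ≠ twoStepCentralizer 𝒜 2

/-- The weight in which the `j`-th constituent ends (counting from `j = 0`); the value is `0` if
there are at most `j` constituents. -/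
noncomputable def constituentEnd (𝒜 : ℕ → Submodule F L) (j : ℕ) : ℕ :=
  Nat.nth (IsConstituentEnd 𝒜) j

/-- The sequence of constituent lengths, counting from `0`. The first constituent
`C_2, …, C_n` has length `n` by convention; a later one `C_{i+1}, …, C_{i+m}` has length `m`.
The value is `0` beyond the last constituent (if there is one), and is positive for every actual
constituent. -/
noncomputable def constituentLength (𝒜 : ℕ → Submodule F L) : ℕ → ℕ
  | 0 => constituentEnd 𝒜 0
  | j + 1 => constituentEnd 𝒜 (j + 1) - constituentEnd 𝒜 j

/-- The first `N` terms of a sequence. -/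
def initialSegment (ℓ : ℕ → ℕ) (N : ℕ) : List ℕ := (List.range N).map ℓ

/-- The infinite sequence `ℓ` is an infinite concatenation `w 0, w 1, w 2, …` of nonempty finite
words from the set `S`. -/
def IsConcatenationOf (S : Set (List ℕ)) (ℓ : ℕ → ℕ) : Prop :=
  ∃ w : ℕ → List ℕ, (∀ n, w n ∈ S ∧ w n ≠ []) ∧
    ∀ n, initialSegment ℓ ((List.range n).flatMap w).length = (List.range n).flatMap w

end MaxClass

/-!
Let `x` and `y` span the second two-step centralizer and `C_2`. After extending the scalars to a
field with an element `ξ` outside `F`, no nonzero homogeneous element of `L` commutes with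
`z = x + ξ y`, so `v_1 = ξ y`, `v_{i+1} = [v_i, z]` are nonzero and `[v_i, v_1] = f i v_{i+1}` for
a sequence `f` with `f i = 0` if and only if `C_i = C_2`, and `f i = 1` if and only if `C_i` is
spanned by `x`. The Jacobi identity turns into a relation between the values of `f` and its
iterated forward differences. In characteristic `p` the `p ^ c`-th difference is
`f (j + p ^ c) - f j`, so taking the relation with about `p ^ (k + h) = r q` differences compares
`f` with its translate by the length `r q` of a block that starts with `2 q`. Inductively, each
block forces the next one to start with `2 q` or `2 q - p ^ β`, to continue with `r - 2`
constituents of length `q`, and to have `f = 1` at every constituent end; the last point says that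
there is no third two-step centralizer.
-/

namespace MaxClass

open Finset

section Differences

theorem fwdDiff_iter_eq_zero {G : Type*} [AddCommGroup G] {f : ℕ → G} {k j : ℕ}
    (hf : ∀ l ≤ k, f (j + l) = 0) : (fwdDiff 1)^[k] f j = 0 := by
  rw [fwdDiff_iter_eq_sum_shift]
  refine sum_eq_zero fun l hl => ?_
  rw [smul_eq_mul, mul_one, hf l (mem_range_succ_iff.mp hl), smul_zero]

variable {R : Type*} [CommRing R]

theorem cast_choose_eq_zero_of_fwdDiff_iter [IsDomain R] {f : ℕ → R} {k j a : ℕ} (ha : a ≤ k)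
    (hf : ∀ l ≤ k, l ≠ a → (k.choose l : R) = 0 ∨ f (j + l) = 0) (hfa : f (j + a) ≠ 0)
    (hΔ : (fwdDiff 1)^[k] f j = 0) : (k.choose a : R) = 0 := by
  rw [fwdDiff_iter_eq_sum_shift, sum_eq_single_of_mem a (mem_range_succ_iff.mpr ha)] at hΔ
  · simpa [hfa] using hΔ
  · intro l hl hla
    rcases hf l (mem_range_succ_iff.mp hl) hla with hchoose | hfl
    · simp [hchoose]
    · simp [hfl]

variable (p : ℕ) [Fact p.Prime] [CharP R p]

theorem fwdDiff_iter_prime_pow {M : Type*} [AddCommMonoid M] (h : M) (f : M → R) (n : ℕ) :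
    (fwdDiff h)^[p ^ n] f = fwdDiff (p ^ n • h) f := by
  have hp : p.Prime := Fact.out
  have hpos : 0 < p ^ n := pow_pos hp.pos n
  funext y
  rw [fwdDiff_iter_eq_sum_shift, sum_eq_add_of_mem (p ^ n) 0 (self_mem_range_succ _)
    (mem_range_succ_iff.mpr hpos.le) hpos.ne']
  · simp [fwdDiff, neg_one_pow_char_pow R p n, sub_eq_add_neg]
  · rintro l - ⟨hl, hl0⟩
    have hchoose : ((p ^ n).choose l : R) = 0 :=
      (CharP.cast_eq_zero_iff R p _).mpr (hp.dvd_choose_pow hl0 hl)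
    rw [zsmul_eq_mul, Int.cast_mul, Int.cast_natCast, hchoose, mul_zero, zero_mul]

theorem fwdDiff_iter_prime_pow_sub_one (f : ℕ → R) (n j : ℕ) :
    (fwdDiff 1)^[p ^ n - 1] f j = ∑ l ∈ range (p ^ n), f (j + l) := by
  have hf : f = fwdDiff 1 fun i => ∑ l ∈ range i, f l :=
    funext fun i => (sum_range_succ_sub_sum f).symm
  have hpos : 0 < p ^ n := pow_pos (Fact.out : p.Prime).pos n
  conv_lhs => rw [hf, ← Function.iterate_succ_apply, Nat.succ_eq_add_one,
    Nat.sub_add_cancel hpos, fwdDiff_iter_prime_pow, smul_eq_mul, mul_one]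
  exact sum_range_add_sub_sum_range _ _ _

theorem fwdDiff_iter_prime_pow_add (f : ℕ → R) (n k : ℕ) :
    (fwdDiff 1)^[p ^ n + k] f = (fwdDiff 1)^[k] (fwdDiff (p ^ n) f) := by
  rw [add_comm, Function.iterate_add_apply, fwdDiff_iter_prime_pow, smul_eq_mul, mul_one]

end Differences

section Binomials

variable {R : Type*} [AddGroupWithOne R] (p : ℕ) [Fact p.Prime] [CharP R p]

theorem cast_choose_prime_pow (n v : ℕ) : (n.choose (p ^ v) : R) = (n / p ^ v : ℕ) := by
  have hp : p.Prime := Fact.out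
  have hlucas := Choose.choose_modEq_choose_mul_prod_range_choose (p := p) (n := n) (k := p ^ v) v
  have hprod : ∏ i ∈ range v, (n / p ^ i % p).choose (p ^ v / p ^ i % p) = 1 :=
    prod_eq_one fun i hi => by
      have hi : i < v := mem_range.mp hi
      rw [Nat.pow_div hi.le hp.pos, Nat.mod_eq_zero_of_dvd (dvd_pow_self p (by omega)),
        Nat.choose_zero_right]
  rw [Nat.div_self (pow_pos hp.pos v), Nat.choose_one_right, hprod, Nat.cast_one, mul_one]
    at hlucas
  rw [CharP.cast_eq_iff_mod_eq R p]
  exact Int.natCast_modEq_iff.mp hlucas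

theorem cast_choose_eq_zero {n k b : ℕ} (hn : p ^ b ∣ n) (hk : ¬ p ^ b ∣ k) :
    (n.choose k : R) = 0 := by
  rw [CharP.cast_eq_zero_iff R p]
  by_contra hchoose
  have hle := Nat.Prime.emultiplicity_le_emultiplicity_choose_add (Fact.out : p.Prime) n k
  rw [emultiplicity_eq_zero.mpr hchoose, zero_add] at hle
  exact hk (pow_dvd_of_le_emultiplicity ((le_emultiplicity_of_pow_dvd hn).trans hle))

theorem cast_choose_prime_pow_eq_neg_one {M N v : ℕ} (hM : p ^ (v + 1) ∣ M) (hN : N < M)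
    (hMN : M ≤ N + p ^ v) : (N.choose (p ^ v) : R) = -1 := by
  have hpos : 0 < p ^ v := pow_pos (Fact.out : p.Prime).pos v
  obtain ⟨c, rfl⟩ := hM
  have hdiv : N / p ^ v + 1 = p * c := by
    rw [pow_succ, mul_assoc] at hN hMN
    have hlt := Nat.div_lt_of_lt_mul hN
    have hle := Nat.div_le_div_right (c := p ^ v) hMN
    rw [Nat.mul_div_cancel_left _ hpos, Nat.add_div_right _ hpos] at hle
    omega
  rw [cast_choose_prime_pow, eq_neg_iff_add_eq_zero, ← Nat.cast_succ, Nat.succ_eq_add_one, hdiv,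
    CharP.cast_eq_zero_iff R p]
  exact dvd_mul_right p c

theorem dvd_of_cast_choose_eq_zero {m v : ℕ} (hm : p ^ v ∣ m)
    (h : ((m + p ^ v - 1).choose (p ^ v) : R) = 0) : p ^ (v + 1) ∣ m := by
  have hpos : 0 < p ^ v := pow_pos (Fact.out : p.Prime).pos v
  obtain ⟨a, rfl⟩ := hm
  rw [cast_choose_prime_pow, CharP.cast_eq_zero_iff R p,
    show p ^ v * a + p ^ v - 1 = p ^ v - 1 + p ^ v * a by omega, Nat.add_mul_div_left _ _ hpos,
    Nat.div_eq_of_lt (by omega), zero_add] at h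
  exact pow_succ p v ▸ mul_dvd_mul_left _ h

theorem mul_pow_le_pow {c p m n : ℕ} (hc : c ≤ p) (hp : 0 < p) (hmn : m < n) :
    c * p ^ m ≤ p ^ n :=
  calc c * p ^ m ≤ p * p ^ m := Nat.mul_le_mul_right _ hc
    _ = p ^ (m + 1) := (pow_succ' p m).symm
    _ ≤ p ^ n := Nat.pow_le_pow_right hp hmn

end Binomials

section Gaps

variable {R : Type*} [Zero R] {f : ℕ → R}

/-- The first nonzero term of `f` after position `j` is in position `j + m`. -/
structure IsGap (f : ℕ → R) (j m : ℕ) : Prop where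
  pos : 0 < m
  ne_zero : f (j + m) ≠ 0
  eq_zero : ∀ s, 0 < s → s < m → f (j + s) = 0

/-- Any two nonzero terms of `f` in positive positions are at distance at least `q`. -/
def IsSparse (q : ℕ) (f : ℕ → R) : Prop :=
  ∀ ⦃a b⦄, 1 ≤ a → a < b → f a ≠ 0 → f b ≠ 0 → a + q ≤ b

theorem exists_isGap {j s : ℕ} (hs : 0 < s) (hf : f (j + s) ≠ 0) : ∃ m ≤ s, IsGap f j m := by
  classical
  have hex : ∃ m, 0 < m ∧ f (j + m) ≠ 0 := ⟨s, hs, hf⟩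
  exact ⟨Nat.find hex, Nat.find_le ⟨hs, hf⟩, (Nat.find_spec hex).1, (Nat.find_spec hex).2,
    fun t ht htm => by_contra fun hne => Nat.find_min hex htm ⟨ht, hne⟩⟩

theorem IsGap.le {j m s : ℕ} (hm : IsGap f j m) (hs : 0 < s) (hf : f (j + s) ≠ 0) : m ≤ s :=
  not_lt.mp fun hlt => hf (hm.eq_zero s hs hlt)

theorem IsGap.eq {j m m' : ℕ} (hm : IsGap f j m) (hm' : IsGap f j m') : m = m' :=
  le_antisymm (hm.le hm'.pos hm'.ne_zero) (hm'.le hm.pos hm.ne_zero)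

theorem IsSparse.le_gap {q j m : ℕ} (hf : IsSparse q f) (hj : 1 ≤ j) (hfj : f j ≠ 0)
    (hm : IsGap f j m) : q ≤ m := by
  have := hf hj (Nat.lt_add_of_pos_right hm.pos) hfj hm.ne_zero
  omega

theorem IsSparse.eq_zero {q j m s : ℕ} (hf : IsSparse q f) (hm : IsGap f j m) (hs : 0 < s)
    (hsm : s < m + q) (hne : s ≠ m) : f (j + s) = 0 := by
  by_contra hfs
  have hlt : m < s := lt_of_le_of_ne (hm.le hs hfs) hne.symm
  have := hf (a := j + m) (by have := hm.pos; omega) (by omega) hm.ne_zero hfs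
  omega

end Gaps

section Windows

variable {R : Type*} [AddCommMonoid R] {f : ℕ → R} {q : ℕ}

theorem IsSparse.sum_window (hf : IsSparse q f) {a b : ℕ} (ha : 1 ≤ a) (hab : a ≤ b)
    (hba : b < a + q) (hfb : f b ≠ 0) : ∑ l ∈ range q, f (a + l) = f b := by
  rw [sum_eq_single_of_mem (b - a) (mem_range.mpr (by omega)), Nat.add_sub_cancel' hab]
  intro l hl hne
  have hl : l < q := mem_range.mp hl
  by_contra hfl
  rcases lt_or_gt_of_ne (show a + l ≠ b by omega) with hlt | hlt
  · have := hf (by omega) hlt hfl hfb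
    omega
  · have := hf (by omega) hlt hfb hfl
    omega

theorem IsGap.sum_window_eq_zero {j m a : ℕ} (hm : IsGap f j m) (ha : 1 ≤ a) (ham : a + q ≤ m) :
    ∑ l ∈ range q, f (j + a + l) = 0 :=
  sum_eq_zero fun l hl => by
    have hl : l < q := mem_range.mp hl
    rw [add_assoc]
    exact hm.eq_zero _ (by omega) (by omega)

end Windows

section Jacobi

variable {R : Type*} [CommRing R] {f : ℕ → R}

/-- The Jacobi identity of `v j`, `v (k + 1)`, `v 1`, written in terms of `f`, when the elements
`v i` satisfy `⁅v i, z⁆ = v (i + 1)` and `⁅v i, v 1⁆ = f i • v (i + 1)`. Then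
`⁅v j, v (k + 1)⁆ = ((-1) ^ k * (fwdDiff 1)^[k] f j) • v (j + k + 1)`. -/
def JacobiRel (f : ℕ → R) : Prop :=
  ∀ k j, 1 ≤ j → (fwdDiff 1)^[k] f j * (f (k + 1 + j) - f (k + 1)) =
    (fwdDiff 1)^[k] f (j + 1) * (f j - f (k + 1))

variable [IsDomain R]

theorem JacobiRel.fwdDiff_eq_zero (hf : JacobiRel f) {k j : ℕ} (hj : 1 ≤ j) (hfj : f j ≠ 0)
    (hfk : f (k + 1) = 0) (hkj : (fwdDiff 1)^[k] f j * f (k + 1 + j) = 0) :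
    (fwdDiff 1)^[k] f (j + 1) = 0 := by
  have hrel := hf k j hj
  rw [hfk, sub_zero, sub_zero, hkj] at hrel
  exact (mul_eq_zero.mp hrel.symm).resolve_right hfj

theorem JacobiRel.exists_gap_le (hf : JacobiRel f) {m j : ℕ} (hm : IsGap f 0 m) (hj : 1 ≤ j)
    (hfj : f j ≠ 0) : ∃ m' ≤ m, IsGap f j m' := by
  by_contra! hnot
  have hpos := hm.pos
  have hzero : ∀ s, 0 < s → s ≤ m → f (j + s) = 0 := fun s hs hsm => by
    by_contra hfs
    obtain ⟨m', hm's, hm'⟩ := exists_isGap hs hfs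
    exact hnot m' (hm's.trans hsm) hm'
  have hrel := hf (m - 1) j hj
  rw [Nat.sub_add_cancel hpos, add_comm m j, hzero m hpos le_rfl, zero_sub,
    fwdDiff_iter_eq_zero (j := j + 1), zero_mul] at hrel
  · have hfm : f m ≠ 0 := by simpa using hm.ne_zero
    have hΔ := (mul_eq_zero.mp hrel).resolve_right (neg_ne_zero.mpr hfm)
    have := cast_choose_eq_zero_of_fwdDiff_iter (a := 0) (Nat.zero_le _)
      (fun l hl hl0 => Or.inr (hzero l (by omega) (by omega))) hfj hΔ
    simp at this
  · intro l hl
    rw [add_assoc]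
    exact hzero _ (by omega) (by omega)

section CharP

variable {p : ℕ} [Fact p.Prime] [CharP R p] {h : ℕ}

theorem JacobiRel.isSparse (hf : JacobiRel f) {m : ℕ} (hm : IsGap f 0 m) (hhm : p ^ h < m) :
    IsSparse (p ^ h) f := by
  intro a b
  induction b using Nat.strong_induction_on generalizing a with
  | _ b ih =>
    intro ha hab hfa hfb
    by_contra! hlt
    have hpos : 0 < p ^ h := pow_pos (Fact.out : p.Prime).pos h
    have hma : m ≤ a := hm.le ha (by rwa [zero_add])
    obtain ⟨j, rfl⟩ : ∃ j, b = p ^ h + j := ⟨b - p ^ h, by omega⟩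
    have hzero : ∀ c, 1 ≤ c → c ≠ a → c < p ^ h + j → a < c + p ^ h → f c = 0 := by
      intro c hc hne hcb hac
      by_contra hfc
      rcases lt_or_gt_of_ne hne with hlt' | hlt'
      · have := ih a hab hc hlt' hfc hfa
        omega
      · have := ih c hcb ha hlt' hfa hfc
        omega
    have hsum : ∑ l ∈ range (p ^ h), f (j + l) = f a := by
      rw [sum_eq_single_of_mem (a - j) (mem_range.mpr (by omega)), Nat.add_sub_cancel' (by omega)]
      intro l hl hne
      have hl : l < p ^ h := mem_range.mp hl
      exact hzero _ (by omega) (by omega) (by omega) (by omega)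
    have hrel := hf (p ^ h - 1) j (by omega)
    have hfq : f (p ^ h) = 0 := by simpa using hm.eq_zero _ hpos hhm
    rw [fwdDiff_iter_prime_pow_sub_one, hsum, Nat.sub_add_cancel hpos, hfq, sub_zero, sub_zero,
      hzero j (by omega) (by omega) (by omega) (by omega), mul_zero] at hrel
    exact mul_ne_zero hfa hfb hrel

theorem JacobiRel.pow_succ_dvd_gap (hf : JacobiRel f) (h0 : IsGap f 0 (2 * p ^ h)) {j m v : ℕ}
    (hj : 1 ≤ j) (hfj : f j ≠ 0) (hm : IsGap f j m) (hvm : p ^ v ∣ m)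
    (hlt : m + p ^ v < 2 * p ^ h) : p ^ (v + 1) ∣ m := by
  have hp : p.Prime := Fact.out
  have hsparse : IsSparse (p ^ h) f := hf.isSparse h0 (by have := pow_pos hp.pos h; omega)
  have hvpos : 0 < p ^ v := pow_pos hp.pos v
  have hvle : p ^ v ≤ m := Nat.le_of_dvd hm.pos hvm
  obtain ⟨N, hN⟩ : ∃ N, N + 1 = m + p ^ v := ⟨m + p ^ v - 1, by omega⟩
  have hΔ := hf.fwdDiff_eq_zero (k := N) hj hfj
    (by rw [hN]; simpa using h0.eq_zero (m + p ^ v) (by omega) hlt)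
    (by rw [hN, add_comm (m + p ^ v) j, hsparse.eq_zero hm (by omega) (by omega) (by omega),
      mul_zero])
  have hchoose := cast_choose_eq_zero_of_fwdDiff_iter (a := m - 1) (by omega)
    (fun l hl hne => Or.inr <| by
      rw [add_assoc]
      exact hsparse.eq_zero hm (by omega) (by omega) (by omega))
    (by rw [add_assoc, Nat.add_sub_cancel' hm.pos]; exact hm.ne_zero) hΔ
  rw [← Nat.choose_symm_of_eq_add (show N = p ^ v + (m - 1) by omega),
    show N = m + p ^ v - 1 by omega] at hchoose
  exact dvd_of_cast_choose_eq_zero p hvm hchoose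

theorem JacobiRel.gap_eq (hf : JacobiRel f) (h0 : IsGap f 0 (2 * p ^ h)) {j m : ℕ} (hj : 1 ≤ j)
    (hfj : f j ≠ 0) (hm : IsGap f j m) : m = 2 * p ^ h ∨ ∃ g ≤ h, m + p ^ g = 2 * p ^ h := by
  have hp : p.Prime := Fact.out
  obtain ⟨m', hm'le, hm'⟩ := hf.exists_gap_le h0 hj hfj
  rw [← hm.eq hm'] at hm'le
  refine hm'le.eq_or_lt.imp_right fun hlt => ?_
  obtain ⟨v, a, hpa, hma⟩ := Nat.exists_eq_pow_mul_and_not_dvd hm.pos.ne' p hp.ne_one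
  have hvm : p ^ v ∣ m := ⟨a, hma⟩
  have hvh : v ≤ h := by
    have : p ^ v < p ^ (h + 1) := (Nat.le_of_dvd hm.pos hvm).trans_lt
      (hlt.trans_le (pow_succ' p h ▸ Nat.mul_le_mul_right _ hp.two_le))
    exact Nat.lt_succ_iff.mp ((Nat.pow_lt_pow_iff_right hp.one_lt).mp this)
  have hle : p ^ v ≤ 2 * p ^ h - m :=
    Nat.le_of_dvd (by omega) (Nat.dvd_sub ((pow_dvd_pow p hvh).mul_left 2) hvm)
  refine ⟨v, hvh, by_contra fun hne => hpa ?_⟩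
  have hdvd := hf.pow_succ_dvd_gap h0 hj hfj hm hvm (by omega)
  rw [hma, pow_succ] at hdvd
  exact Nat.dvd_of_mul_dvd_mul_left (pow_pos hp.pos v) hdvd

end CharP

end Jacobi

section Translation

variable {R : Type*} [CommRing R] [IsDomain R] {f : ℕ → R} {p : ℕ} [Fact p.Prime] [CharP R p]

theorem JacobiRel.apply_add_of_apply_eq (hf : JacobiRel f) {c m j s : ℕ} (hm : IsGap f (p ^ c) m)
    (hj : 1 ≤ j) (hfj : f j ≠ 0) (hper : f (j + p ^ c) = f j) (hs : s < m) :
    f (j + p ^ c + s) = f (j + s) := by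
  induction s using Nat.strong_induction_on with
  | _ s ih =>
    rcases Nat.eq_zero_or_pos s with rfl | hs0
    · exact hper
    obtain ⟨t, rfl⟩ : ∃ t, s = t + 1 := ⟨s - 1, by omega⟩
    have hzero : ∀ l ≤ t, fwdDiff (p ^ c) f (j + l) = 0 := fun l hl => by
      rw [fwdDiff, add_right_comm, ih l (by omega) (by omega), sub_self]
    by_contra hne
    have hΔ := hf.fwdDiff_eq_zero (k := p ^ c + t) hj hfj (hm.eq_zero _ hs0 hs)
      (by rw [fwdDiff_iter_prime_pow_add, fwdDiff_iter_eq_zero hzero, zero_mul])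
    rw [fwdDiff_iter_prime_pow_add] at hΔ
    have hchoose := cast_choose_eq_zero_of_fwdDiff_iter (a := t) le_rfl
      (fun l hl hlt => Or.inr <| by
        rw [add_assoc]
        exact hzero _ (by omega))
      (by rwa [fwdDiff, sub_ne_zero, add_right_comm j 1 t, add_assoc j t 1,
        add_right_comm j (t + 1)]) hΔ
    simp at hchoose

theorem JacobiRel.sum_window_add (hf : JacobiRel f) {c h m j : ℕ} (hm : IsGap f (p ^ c) m)
    (hhm : p ^ h < m) (hj : 1 ≤ j) (hfj : f j ≠ 0) (hfjc : f (j + p ^ c + p ^ h) = 0) :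
    ∑ l ∈ range (p ^ h), f (j + p ^ c + 1 + l) = ∑ l ∈ range (p ^ h), f (j + 1 + l) := by
  have hpos : 0 < p ^ h := pow_pos (Fact.out : p.Prime).pos h
  have hN : p ^ c + (p ^ h - 1) + 1 = p ^ c + p ^ h := by omega
  have hΔ := hf.fwdDiff_eq_zero (k := p ^ c + (p ^ h - 1)) hj hfj
    (by rw [hN]; exact hm.eq_zero _ hpos hhm)
    (by rw [hN, add_comm _ j, ← add_assoc, hfjc, mul_zero])
  rw [fwdDiff_iter_prime_pow_add, fwdDiff_iter_prime_pow_sub_one] at hΔ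
  simp only [fwdDiff, sum_sub_distrib] at hΔ
  rw [← sub_eq_zero, ← hΔ]
  congr 1
  exact sum_congr rfl fun l _ => congrArg f (by omega)

end Translation

theorem IsSparse.sum_range_mul {R : Type*} [AddCommMonoidWithOne R] [NeZero (1 : R)] {f : ℕ → R}
    {q : ℕ} (hf : IsSparse q f) {j t : ℕ} (hj : 1 ≤ j) (hq : 0 < q)
    (hone : ∀ a < t, f (j + a * q) = 1) :
    ∑ l ∈ range (t * q), f (j + l) = t := by
  induction t with
  | zero => simp
  | succ t ih =>
    have hlast := hone t (Nat.lt_succ_self t)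
    rw [add_mul, one_mul, sum_range_add, ih fun a ha => hone a (by omega), Nat.cast_succ]
    simp only [← add_assoc]
    rw [hf.sum_window (b := j + t * q) (by omega) le_rfl (by omega) (by simp [hlast]), hlast]

section Blocks

variable {R : Type*} [CommRing R] {f : ℕ → R}

/-- In position `n` the sequence `f` has a block: a gap `2 * q` or `2 * q - e` followed by `r - 2`
gaps `q`, where `f` takes the value `1` at all these nonzero terms, and also in position `n`
unless `n = 0`. The next block then starts in position `n + m + (r - 2) * q`. -/
structure IsBlock (q e r : ℕ) (f : ℕ → R) (n m : ℕ) : Prop where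
  start : n ≠ 0 → f n = 1
  gap_mem : m = 2 * q ∨ m + e = 2 * q
  isGap : IsGap f n m
  apply_eq_one : ∀ a, a + 2 ≤ r → f (n + m + a * q) = 1

/-- The data on the initial segment of a sequence: a first block with gap `2 * p ^ h`, followed by a
gap `2 * p ^ h - p ^ β`, with all nonzero terms equal to `1`. -/
structure IsSeeded (p h k β : ℕ) (f : ℕ → R) : Prop where
  jacobi : JacobiRel f
  isBlock_zero : IsBlock (p ^ h) (p ^ β) (p ^ k) f 0 (2 * p ^ h)
  isGap : IsGap f (p ^ (k + h)) (2 * p ^ h - p ^ β)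
  apply_eq_one : f (p ^ (k + h) + (2 * p ^ h - p ^ β)) = 1

variable {p h k β : ℕ}

theorem IsSeeded.isGap_zero (hf : IsSeeded p h k β f) : IsGap f 0 (2 * p ^ h) :=
  hf.isBlock_zero.isGap

theorem sub_two_mul_pow_add {p k : ℕ} (hp : 2 ≤ p) (hk : 1 ≤ k) (h : ℕ) :
    (p ^ k - 2) * p ^ h + 2 * p ^ h = p ^ (k + h) := by
  rw [← add_mul, Nat.sub_add_cancel (hp.trans (Nat.le_self_pow (by omega) p)), pow_add]

theorem IsBlock.apply_next_eq_one {e n m n' : ℕ} (hB : IsBlock (p ^ h) e (p ^ k) f n m)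
    (hp : 2 ≤ p) (hk : 1 ≤ k) (hn' : n + m + p ^ (k + h) = n' + 2 * p ^ h) : f n' = 1 := by
  have hr : 2 ≤ p ^ k := hp.trans (Nat.le_self_pow (by omega) p)
  have hperiod := sub_two_mul_pow_add hp hk h
  rw [← hB.apply_eq_one (p ^ k - 2) (Nat.sub_add_cancel hr).le,
    show n' = n + m + (p ^ k - 2) * p ^ h by omega]

theorem IsSeeded.apply_period (hf : IsSeeded p h k β f) (hp : 2 ≤ p) (hk : 1 ≤ k) :
    f (p ^ (k + h)) = 1 :=
  hf.isBlock_zero.apply_next_eq_one hp hk (by omega)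

variable [IsDomain R] {n m n' m' : ℕ}

theorem IsSeeded.gap_le (hf : IsSeeded p h k β f) (hn : 1 ≤ n) (hfn : f n ≠ 0)
    (hm : IsGap f n m) : m ≤ 2 * p ^ h := by
  obtain ⟨m', hm'le, hm'⟩ := hf.jacobi.exists_gap_le hf.isGap_zero hn hfn
  rwa [hm.eq hm']

variable [Fact p.Prime] [CharP R p]

theorem IsSeeded.isSparse (hf : IsSeeded p h k β f) : IsSparse (p ^ h) f :=
  hf.jacobi.isSparse hf.isGap_zero <| by
    have := pow_pos (Fact.out : p.Prime).pos h
    omega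

theorem IsSeeded.sum_period (hf : IsSeeded p h k β f) (hk : 1 ≤ k)
    (hB : IsBlock (p ^ h) (p ^ β) (p ^ k) f n m) (hn' : n + m + p ^ (k + h) = n' + 2 * p ^ h) :
    ∑ l ∈ range (p ^ (k + h)), f (n + m + l) =
      ∑ l ∈ range (p ^ h), f (n' + p ^ h + l) - 1 := by
  have hp : p.Prime := Fact.out
  have hr : 2 ≤ p ^ k := hp.two_le.trans (Nat.le_self_pow (by omega) p)
  have hperiod : p ^ (k + h) = (p ^ k - 1) * p ^ h + p ^ h := by
    rw [← Nat.succ_mul, Nat.succ_eq_add_one, Nat.sub_add_cancel (by omega), pow_add]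
  -- All windows of length `p ^ h` but the last one start with a term `1`, and `p ^ k = 0` in `R`.
  rw [hperiod, sum_range_add, hf.isSparse.sum_range_mul (by have := hB.isGap.pos; omega)
    (pow_pos hp.pos h) fun a ha => hB.apply_eq_one a (by omega), Nat.cast_sub (by omega)]
  simp only [Nat.cast_pow, CharP.cast_eq_zero R p, zero_pow (show k ≠ 0 by omega), Nat.cast_one,
    zero_sub, ← add_assoc, show n + m + (p ^ k - 1) * p ^ h = n' + p ^ h by omega]
  ring

theorem IsSeeded.head_eq_one (hf : IsSeeded p h k β f) (hk : 1 ≤ k)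
    (hB : IsBlock (p ^ h) (p ^ β) (p ^ k) f n m) (hn' : n + m + p ^ (k + h) = n' + 2 * p ^ h)
    (hm' : IsGap f n' m') (hlt : p ^ h < m') : f (n' + m') = 1 := by
  have hp : p.Prime := Fact.out
  have hr : 2 ≤ p ^ k := hp.two_le.trans (Nat.le_self_pow (by omega) p)
  have hperiod := sub_two_mul_pow_add hp.two_le hk h
  have hmpos := hB.isGap.pos
  have hle := hf.gap_le (by omega) (by simp [hB.apply_next_eq_one hp.two_le hk hn']) hm'
  have hone : f (n + m) = 1 := by simpa using hB.apply_eq_one 0 hr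
  have hrel := hf.jacobi (p ^ (k + h) - 1) (n + m) (by omega)
  rw [fwdDiff_iter_prime_pow_sub_one, hf.sum_period hk hB hn',
    Nat.sub_add_cancel (pow_pos hp.pos _), hf.apply_period hp.two_le hk, hone, sub_self, mul_zero,
    show p ^ (k + h) + (n + m) = n' + 2 * p ^ h by omega] at hrel
  rcases hle.eq_or_lt with rfl | hlt'
  · rw [hm'.sum_window_eq_zero (pow_pos hp.pos h) (by omega)] at hrel
    linear_combination -hrel
  · rw [hf.isSparse.eq_zero hm' (by omega) (by omega) (by omega),
      hf.isSparse.sum_window (b := n' + m') (by omega) (by omega) (by omega) hm'.ne_zero] at hrel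
    linear_combination -hrel

theorem IsSeeded.le_gap_after_long (hf : IsSeeded p h k β f) (hk : 1 ≤ k)
    (hB : IsBlock (p ^ h) (p ^ β) (p ^ k) f n (2 * p ^ h)) (hn : n ≠ 0)
    (hm' : IsGap f (n + p ^ (k + h)) m') : 2 * p ^ h - p ^ β ≤ m' := by
  by_contra! hlt
  have hfn := hB.start hn
  have hfn' : f (n + p ^ (k + h)) = 1 :=
    hB.apply_next_eq_one (Fact.out : p.Prime).two_le hk (by omega)
  have htrans := hf.jacobi.apply_add_of_apply_eq hf.isGap (Nat.pos_of_ne_zero hn)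
    (by simp [hfn]) (hfn'.trans hfn.symm) hlt
  exact hm'.ne_zero (htrans.trans (hB.isGap.eq_zero _ hm'.pos (by omega)))

theorem IsSeeded.gap_after_long_eq (hf : IsSeeded p h k β f) (hk : 1 ≤ k) (hβ : β < h)
    (hB : IsBlock (p ^ h) (p ^ β) (p ^ k) f n (2 * p ^ h)) (hn : n ≠ 0)
    (hm' : IsGap f (n + p ^ (k + h)) m') (hlt : 2 * p ^ h < m' + p ^ β) : m' = 2 * p ^ h := by
  have hp : p.Prime := Fact.out
  have hβh : p ^ β < p ^ h := Nat.pow_lt_pow_right hp.one_lt hβ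
  have hn' : n + 2 * p ^ h + p ^ (k + h) = n + p ^ (k + h) + 2 * p ^ h := by omega
  have hle := hf.gap_le (by omega) (by simp [hB.apply_next_eq_one hp.two_le hk hn']) hm'
  have hfm' := hf.head_eq_one hk hB hn' hm' (by omega)
  by_contra! hne
  -- `j` is chosen so that the Jacobi relation at the seeded position, where `f` is `1`, involves
  -- `f (n + p ^ (k + h) + m') = 1`: its left side vanishes, so the difference on the right is `0`.
  obtain ⟨j, hj⟩ : ∃ j, j + 2 * p ^ h = n + p ^ β + m' :=
    ⟨n + p ^ β + m' - 2 * p ^ h, by omega⟩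
  have hfj : f j = 0 := by
    rw [show j = n + (j - n) by omega]
    exact hB.isGap.eq_zero _ (by omega) (by omega)
  have hrel := hf.jacobi (p ^ (k + h) + (2 * p ^ h - p ^ β - 1)) j (by omega)
  rw [show p ^ (k + h) + (2 * p ^ h - p ^ β - 1) + 1 = p ^ (k + h) + (2 * p ^ h - p ^ β) by omega,
    hf.apply_eq_one, show p ^ (k + h) + (2 * p ^ h - p ^ β) + j = n + p ^ (k + h) + m' by omega,
    hfm', hfj, sub_self, mul_zero, zero_sub, mul_neg, mul_one, zero_eq_neg,
    fwdDiff_iter_prime_pow_add] at hrel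
  have hval : ∀ s, 0 < s → s < 2 * p ^ h →
      fwdDiff (p ^ (k + h)) f (n + s) = f (n + p ^ (k + h) + s) := fun s hs hs' => by
    rw [fwdDiff, hB.isGap.eq_zero s hs hs', sub_zero, add_right_comm]
  have hchoose := cast_choose_eq_zero_of_fwdDiff_iter (a := 2 * p ^ h - p ^ β - 1) le_rfl
    (fun l hl hne' => Or.inr <| by
      rw [show j + 1 + l = n + (j - n + 1 + l) by omega, hval _ (by omega) (by omega)]
      exact hm'.eq_zero _ (by omega) (by omega))
    (by
      rw [show j + 1 + (2 * p ^ h - p ^ β - 1) = n + m' by omega, hval _ hm'.pos (by omega)]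
      exact hm'.ne_zero) hrel
  simp at hchoose

theorem IsSeeded.gap_after_short_eq (hf : IsSeeded p h k β f) (hβ : β < h)
    (hm : IsGap f n m) (hme : m + p ^ β = 2 * p ^ h)
    (hn' : n' + p ^ β = n + p ^ (k + h)) (hm' : IsGap f n' m') (hle : m' ≤ 2 * p ^ h)
    (hlt : 2 * p ^ h < m' + p ^ β) : m' = 2 * p ^ h := by
  have hp : p.Prime := Fact.out
  have hβh : 2 * p ^ β ≤ p ^ h := mul_pow_le_pow hp.two_le hp.pos hβ
  have hβpos : 0 < p ^ β := pow_pos hp.pos β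
  have hdvd : p ^ (β + 1) ∣ 2 * p ^ h := (pow_dvd_pow p hβ).mul_left 2
  by_contra! hne
  -- With `j = n + i` both `f j` and `f` at the far end vanish, so the Jacobi relation equates two
  -- consecutive differences. Of the two terms in the resulting higher difference, the one from
  -- `f (n + m)` has a binomial coefficient divisible by `p`, the other one has coefficient `-1`.
  obtain ⟨i, hi⟩ : ∃ i, i + 2 * p ^ h = p ^ β + m' := ⟨p ^ β + m' - 2 * p ^ h, by omega⟩
  have hrel := hf.jacobi (p ^ (k + h) + (m - 1)) (n + i) (by omega)
  have hend : p ^ (k + h) + (m - 1) + 1 = p ^ (k + h) + (2 * p ^ h - p ^ β) := by omega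
  rw [show p ^ (k + h) + (m - 1) + 1 + (n + i) = n' + (m' + p ^ β) by omega, hend, hf.apply_eq_one,
    hf.isSparse.eq_zero hm' (by omega) (by omega) (by omega),
    hm.eq_zero i (by omega) (by omega), zero_sub, mul_neg, mul_one, mul_neg, mul_one,
    neg_inj] at hrel
  have hΔ : (fwdDiff 1)^[m] (fwdDiff (p ^ (k + h)) f) (n + i) = 0 := by
    rw [← fwdDiff_iter_prime_pow_add, show p ^ (k + h) + m = p ^ (k + h) + (m - 1) + 1 by omega,
      Function.iterate_succ_apply', fwdDiff, ← hrel, sub_self]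
  have hchoose := cast_choose_eq_zero_of_fwdDiff_iter (a := m - p ^ β) (by omega) ?_ ?_ hΔ
  · rw [Nat.choose_symm (by omega), cast_choose_prime_pow_eq_neg_one p hdvd (by omega) (by omega)]
      at hchoose
    simp at hchoose
  · intro l hl hne'
    rcases eq_or_ne l (m - i) with rfl | hne''
    · left
      rw [Nat.choose_symm (by omega)]
      refine cast_choose_eq_zero p (b := β) ?_ (Nat.not_dvd_of_pos_of_lt (by omega) (by omega))
      exact (Nat.dvd_add_left dvd_rfl).mp (hme ▸ (pow_dvd_pow p (Nat.le_succ β)).trans hdvd)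
    · right
      rw [fwdDiff, show n + i + l + p ^ (k + h) = n' + (i + l + p ^ β) by omega, add_assoc n,
        hf.isSparse.eq_zero hm' (by omega) (by omega) (by omega),
        hf.isSparse.eq_zero hm (by omega) (by omega) (by omega), sub_self]
  · rw [fwdDiff, show n + i + (m - p ^ β) + p ^ (k + h) = n' + m' by omega,
      show n + i + (m - p ^ β) = n + (m' - p ^ β) by omega,
      hm.eq_zero _ (by omega) (by omega), sub_zero]
    exact hm'.ne_zero

theorem IsSeeded.not_dvd_gap_after_short (hf : IsSeeded p h k β f) (hβ : β < h)
    (hm : IsGap f n m) (hme : m + p ^ β = 2 * p ^ h) (hn : n ≠ 0) (hfn : f n ≠ 0)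
    (hn' : n' + p ^ β = n + p ^ (k + h)) (hm' : IsGap f n' m') (hle : p ^ h ≤ m')
    (hlt : m' + p ^ β < 2 * p ^ h) : ¬ p ^ (β + 1) ∣ m' := by
  intro hdvd
  have hp : p.Prime := Fact.out
  have hβh : p ^ β < p ^ h := Nat.pow_lt_pow_right hp.one_lt hβ
  have hβpos : 0 < p ^ β := pow_pos hp.pos β
  have hend : p ^ (k + h) + (m' - 1) + 1 = p ^ (k + h) + m' := by omega
  have hΔ := hf.jacobi.fwdDiff_eq_zero (k := p ^ (k + h) + (m' - 1)) (Nat.pos_of_ne_zero hn) hfn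
    (by rw [hend, hf.isGap.eq_zero _ (by omega) (by omega)])
    (by
      rw [hend, show p ^ (k + h) + m' + n = n' + (m' + p ^ β) by omega,
        hf.isSparse.eq_zero hm' (by omega) (by omega) (by omega), mul_zero])
  rw [fwdDiff_iter_prime_pow_add] at hΔ
  have hval : ∀ s, 0 < s → s < m →
      fwdDiff (p ^ (k + h)) f (n + s) = f (n' + (s + p ^ β)) := fun s hs hs' => by
    rw [fwdDiff, hm.eq_zero s hs hs', sub_zero]
    congr 1
    omega
  have hchoose := cast_choose_eq_zero_of_fwdDiff_iter (a := m' - 1 - p ^ β) (by omega)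
    (fun l hl hne => Or.inr <| by
      rw [add_assoc n, hval _ (by omega) (by omega)]
      exact hf.isSparse.eq_zero hm' (by omega) (by omega) (by omega))
    (by
      rw [add_assoc n, hval _ (by omega) (by omega),
        show 1 + (m' - 1 - p ^ β) + p ^ β = m' by omega]
      exact hm'.ne_zero) hΔ
  rw [Nat.choose_symm (by omega), cast_choose_prime_pow_eq_neg_one p hdvd (by omega) (by omega)]
    at hchoose
  simp at hchoose

theorem IsSeeded.gap_mem_next (hf : IsSeeded p h k β f) (hk : 1 ≤ k) (hβ : β < h)
    (hB : IsBlock (p ^ h) (p ^ β) (p ^ k) f n m) (hn' : n + m + p ^ (k + h) = n' + 2 * p ^ h)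
    (hm' : IsGap f n' m') : m' = 2 * p ^ h ∨ m' + p ^ β = 2 * p ^ h := by
  have hp : p.Prime := Fact.out
  have hβpos : 0 < p ^ β := pow_pos hp.pos β
  have hβh : p ^ β < p ^ h := Nat.pow_lt_pow_right hp.one_lt hβ
  rcases eq_or_ne n 0 with rfl | hn
  · obtain rfl := hB.isGap.eq hf.isGap_zero
    obtain rfl : n' = p ^ (k + h) := by omega
    have := hm'.eq hf.isGap
    omega
  have hqw : p ^ h ≤ p ^ (k + h) := Nat.pow_le_pow_right hp.pos (by omega)
  have hfn : f n ≠ 0 := by simp [hB.start hn]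
  have hfn' : f n' ≠ 0 := by simp [hB.apply_next_eq_one hp.two_le hk hn']
  have hm := hB.isGap
  rcases hB.gap_mem with rfl | hme
  · obtain rfl : n' = n + p ^ (k + h) := by omega
    have := hf.le_gap_after_long hk hB hn hm'
    rcases Nat.lt_or_ge (2 * p ^ h) (m' + p ^ β) with hlt | hge
    · exact Or.inl (hf.gap_after_long_eq hk hβ hB hn hm' hlt)
    · omega
  · have hn'e : n' + p ^ β = n + p ^ (k + h) := by omega
    rcases Nat.lt_trichotomy (2 * p ^ h) (m' + p ^ β) with hlt | heq | hgt
    · exact Or.inl (hf.gap_after_short_eq hβ hm hme hn'e hm'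
        (hf.gap_le (by omega) hfn' hm') hlt)
    · exact Or.inr heq.symm
    · refine absurd ?_ (hf.not_dvd_gap_after_short hβ hm hme hn hfn hn'e hm'
        (hf.isSparse.le_gap (by omega) hfn' hm') hgt)
      rcases hf.jacobi.gap_eq hf.isGap_zero (by omega) hfn' hm' with rfl | ⟨g, -, hg⟩
      · omega
      · have hβg : β < g := (Nat.pow_lt_pow_iff_right hp.one_lt).mp (by omega)
        exact (Nat.dvd_add_left (pow_dvd_pow p hβg)).mp (hg ▸ (pow_dvd_pow p hβ).mul_left 2)

theorem IsSeeded.apply_add_eq_one (hf : IsSeeded p h k β f) (hp3 : 3 ≤ p) (hβ : β < h) {j N : ℕ}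
    (hj : 1 ≤ j) (hfj : f j = 1) (hfjq : f (j + p ^ h) = 1) (hN : N + p ^ β = j + p ^ (k + h))
    (hfN : f N = 1) : f (N + p ^ h) = 1 := by
  have hp : p.Prime := Fact.out
  have hβh : 3 * p ^ β ≤ p ^ h := mul_pow_le_pow hp3 hp.pos hβ
  have hβpos : 0 < p ^ β := pow_pos hp.pos β
  have hqw : p ^ h ≤ p ^ (k + h) := Nat.pow_le_pow_right hp.pos (by omega)
  obtain ⟨m, -, hm⟩ := hf.jacobi.exists_gap_le hf.isGap_zero (j := N) (by omega) (by simp [hfN])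
  have hm_eq : m = p ^ h ∨ p ^ h + p ^ β < m := by
    rcases hf.jacobi.gap_eq hf.isGap_zero (by omega) (by simp [hfN]) hm with rfl | ⟨g, hgh, hg⟩
    · omega
    · rcases hgh.eq_or_lt with rfl | hlt
      · omega
      · have : 3 * p ^ g ≤ p ^ h := mul_pow_le_pow hp3 hp.pos hlt
        omega
  have hsum := hf.jacobi.sum_window_add (h := h) hf.isGap (by omega) hj (by simp [hfj])
    (by
      rw [show j + p ^ (k + h) + p ^ h = N + (p ^ h + p ^ β) by omega]
      exact hf.isSparse.eq_zero hm (by omega) (by omega) (by omega))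
  have hright : ∑ l ∈ range (p ^ h), f (j + 1 + l) = 1 :=
    (hf.isSparse.sum_window (b := j + p ^ h) (by omega) (by omega) (by omega)
      (by simp [hfjq])).trans hfjq
  rw [hright, ← hN, add_assoc N] at hsum
  rcases hm_eq with rfl | hlt
  · rw [← hsum, hf.isSparse.sum_window (b := N + p ^ h) (by omega) (by omega) (by omega) hm.ne_zero]
  · rw [hm.sum_window_eq_zero (by omega) (by omega)] at hsum
    simp at hsum

theorem IsSeeded.isBlock_next (hf : IsSeeded p h k β f) (hp3 : 3 ≤ p) (hk : 1 ≤ k) (hβ : β < h)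
    (hB : IsBlock (p ^ h) (p ^ β) (p ^ k) f n m) (hn' : n + m + p ^ (k + h) = n' + 2 * p ^ h)
    (hm' : IsGap f n' m') : IsBlock (p ^ h) (p ^ β) (p ^ k) f n' m' := by
  have hp : p.Prime := Fact.out
  have hβh : p ^ β < p ^ h := Nat.pow_lt_pow_right hp.one_lt hβ
  have hmpos := hB.isGap.pos
  have hmem := hf.gap_mem_next hk hβ hB hn' hm'
  refine ⟨fun _ => hB.apply_next_eq_one hp.two_le hk hn', hmem, hm', fun a ha => ?_⟩
  induction a with
  | zero => simpa using hf.head_eq_one hk hB hn' hm' (by omega)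
  | succ a ih =>
    have hfa := ih (by omega)
    have hfj := hB.apply_eq_one a (by omega)
    have hfjq := hB.apply_eq_one (a + 1) ha
    rw [Nat.succ_mul, ← add_assoc] at hfjq ⊢
    rcases hmem with rfl | hme
    · rw [show n' + 2 * p ^ h + a * p ^ h = n + m + a * p ^ h + p ^ (k + h) by omega] at hfa ⊢
      rw [hf.jacobi.apply_add_of_apply_eq hf.isGap (by omega) (by simp [hfj]) (hfa.trans hfj.symm)
        (by omega), hfjq]
    · exact hf.apply_add_eq_one hp3 hβ (by omega) hfj hfjq (by omega) hfa

end Blocks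

section GapSequence

variable {R : Type*} {f : ℕ → R} {ℓ : ℕ → ℕ}

/-- The nonzero terms of `f` in positive positions are in positions `ℓ 0`, `ℓ 0 + ℓ 1`, …. -/
def IsGapSequence [Zero R] (f : ℕ → R) (ℓ : ℕ → ℕ) : Prop :=
  ∀ t, IsGap f (∑ i ∈ range t, ℓ i) (ℓ t)

theorem isConcatenationOf_of_forall_block {S : Set (List ℕ)} {M : ℕ} (hM : M ≠ 0)
    (hS : ∀ n, (List.range M).map (fun v => ℓ (n * M + v)) ∈ S) : IsConcatenationOf S ℓ := by
  refine ⟨fun n => (List.range M).map fun v => ℓ (n * M + v), fun n => ⟨hS n, by simpa using hM⟩,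
    fun n => ?_⟩
  have hflat : (List.range n).flatMap (fun n => (List.range M).map fun v => ℓ (n * M + v)) =
      initialSegment ℓ (n * M) := by
    induction n with
    | zero => simp [initialSegment]
    | succ n ih =>
      rw [List.range_succ, List.flatMap_append, ih, initialSegment, initialSegment, Nat.succ_mul,
        List.range_add]
      simp [Function.comp_def]
  rw [hflat]
  simp [initialSegment]

theorem apply_of_initialSegment_eq {r a b c : ℕ}
    (hseg : initialSegment ℓ r = [a] ++ List.replicate (r - 2) b ++ [c]) :
    ℓ 0 = a ∧ (∀ i, i + 2 < r → ℓ (i + 1) = b) ∧ ℓ (r - 1) = c := by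
  have hr : r = r - 2 + 1 + 1 := by simpa [initialSegment] using congrArg List.length hseg
  have hget : ∀ i < r, (initialSegment ℓ r)[i]? = some (ℓ i) := fun i hi => by
    simp [initialSegment, hi]
  refine ⟨?_, fun i hi => ?_, ?_⟩
  · have := hget 0 (by omega)
    simpa [hseg] using this.symm
  · have := hget (i + 1) (by omega)
    rw [hseg, List.getElem?_append_left (by simp; omega), List.getElem?_append_right (by simp),
      List.getElem?_replicate_of_lt (by simp; omega)] at this
    exact (Option.some_injective _ this).symm
  · have := hget (r - 1) (by omega)
    rw [hseg, List.getElem?_append_right (by simp; omega)] at this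
    simpa [show r - 1 - (r - 2 + 1) = 0 by omega] using this.symm

theorem IsSparse.isGap [Zero R] {q n : ℕ} (hf : IsSparse q f) (hq : 0 < q) (hn : 1 ≤ n)
    (hfn : f n ≠ 0) (hfq : f (n + q) ≠ 0) : IsGap f n q :=
  ⟨hq, hfq, fun s hs hsq => by_contra fun hfs => by
    have := hf hn (Nat.lt_add_of_pos_right hs) hfn hfs
    omega⟩

variable [CommRing R] {p h k β : ℕ}

theorem IsSparse.apply_gapSequence_of_isBlock [Nontrivial R] {q e r s : ℕ} (hf : IsSparse q f)
    (hq : 0 < q) (hℓ : IsGapSequence f ℓ)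
    (hB : IsBlock q e r f (∑ i ∈ range s, ℓ i) (ℓ s)) {a : ℕ} (ha : a + 2 ≤ r) :
    ∑ i ∈ range (s + 1 + a), ℓ i = ∑ i ∈ range s, ℓ i + ℓ s + a * q ∧
      (a + 2 < r → ℓ (s + 1 + a) = q) := by
  have hpos := hB.isGap.pos
  have hgap : ∀ b, b + 2 < r → IsGap f (∑ i ∈ range s, ℓ i + ℓ s + b * q) q := fun b hb =>
    hf.isGap hq (by omega) (by simp [hB.apply_eq_one b hb.le]) (by
      have := hB.apply_eq_one (b + 1) hb
      rw [Nat.succ_mul, ← add_assoc] at this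
      simp [this])
  induction a with
  | zero =>
    have hsum : ∑ i ∈ range (s + 1), ℓ i = ∑ i ∈ range s, ℓ i + ℓ s := sum_range_succ _ _
    refine ⟨by simpa using hsum, fun hr => (hℓ (s + 1)).eq ?_⟩
    simpa [hsum] using hgap 0 hr
  | succ a ih =>
    obtain ⟨hsum, hqa⟩ := ih (by omega)
    have hsum' : ∑ i ∈ range (s + 1 + (a + 1)), ℓ i =
        ∑ i ∈ range s, ℓ i + ℓ s + (a + 1) * q := by
      rw [← add_assoc (s + 1), sum_range_succ, hsum, hqa (by omega), Nat.succ_mul, add_assoc]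
    refine ⟨hsum', fun hr => (hℓ _).eq ?_⟩
    rw [hsum']
    exact hgap (a + 1) hr

theorem isSeeded_of_initialSegment_eq (hp : 2 ≤ p) (hk : 1 ≤ k) (hf : JacobiRel f)
    (hℓ : IsGapSequence f ℓ)
    (hseg : initialSegment ℓ (p ^ k) =
      [2 * p ^ h] ++ List.replicate (p ^ k - 2) (p ^ h) ++ [2 * p ^ h - p ^ β])
    (hone : ∀ t < p ^ k, f (∑ i ∈ range (t + 1), ℓ i) = 1) : IsSeeded p h k β f := by
  have hr : 2 ≤ p ^ k := hp.trans (Nat.le_self_pow (by omega) p)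
  obtain ⟨hfirst, hmid, hlast⟩ := apply_of_initialSegment_eq hseg
  have hsum : ∀ a, a + 2 ≤ p ^ k → ∑ i ∈ range (a + 1), ℓ i = 2 * p ^ h + a * p ^ h := by
    intro a ha
    induction a with
    | zero => simp [hfirst]
    | succ a ih => rw [sum_range_succ, ih (by omega), hmid a ha, add_assoc, ← Nat.succ_mul]
  have hperiod : ∑ i ∈ range (p ^ k - 1), ℓ i = p ^ (k + h) := by
    rw [show p ^ k - 1 = p ^ k - 2 + 1 by omega, hsum _ (by omega), add_comm,
      sub_two_mul_pow_add hp hk]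
  have hgap0 : IsGap f 0 (2 * p ^ h) := by simpa [hfirst] using hℓ 0
  refine ⟨hf, ⟨fun h0 => absurd rfl h0, Or.inl rfl, hgap0, fun a ha => ?_⟩, ?_, ?_⟩
  · rw [zero_add, ← hsum a ha]
    exact hone a (by omega)
  · rw [← hperiod, ← hlast]
    exact hℓ _
  · rw [← hperiod, ← hlast, ← sum_range_succ]
    exact hone _ (by omega)

variable [IsDomain R] [Fact p.Prime] [CharP R p]

theorem IsSeeded.isBlock (hf : IsSeeded p h k β f) (hp3 : 3 ≤ p) (hk : 1 ≤ k) (hβ : β < h)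
    (hℓ : IsGapSequence f ℓ) (i : ℕ) :
    IsBlock (p ^ h) (p ^ β) (p ^ k) f (∑ t ∈ range (i * (p ^ k - 1)), ℓ t)
      (ℓ (i * (p ^ k - 1))) := by
  have hp : p.Prime := Fact.out
  induction i with
  | zero =>
    have hgap : IsGap f 0 (ℓ 0) := by simpa using hℓ 0
    simpa [hgap.eq hf.isGap_zero] using hf.isBlock_zero
  | succ i ih =>
    have hr : 2 ≤ p ^ k := hp.two_le.trans (Nat.le_self_pow (by omega) p)
    have hsum := (hf.isSparse.apply_gapSequence_of_isBlock (pow_pos hp.pos h) hℓ ih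
      (a := p ^ k - 2) (by omega)).1
    rw [add_assoc, show 1 + (p ^ k - 2) = p ^ k - 1 by omega, ← Nat.succ_mul] at hsum
    have hperiod := sub_two_mul_pow_add hp.two_le hk h
    exact hf.isBlock_next hp3 hk hβ ih (by rw [hsum]; omega) (hℓ _)

theorem IsSeeded.apply_sum_gapSequence_eq_one (hf : IsSeeded p h k β f) (hp3 : 3 ≤ p)
    (hk : 1 ≤ k) (hβ : β < h) (hℓ : IsGapSequence f ℓ) (t : ℕ) :
    f (∑ i ∈ range (t + 1), ℓ i) = 1 := by
  have hp : p.Prime := Fact.out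
  have hr : 2 ≤ p ^ k := hp.two_le.trans (Nat.le_self_pow (by omega) p)
  have hB := hf.isBlock hp3 hk hβ hℓ (t / (p ^ k - 1))
  have ha : t % (p ^ k - 1) + 2 ≤ p ^ k := by
    have := Nat.mod_lt t (show 0 < p ^ k - 1 by omega)
    omega
  have hsum := (hf.isSparse.apply_gapSequence_of_isBlock (pow_pos hp.pos h) hℓ hB ha).1
  rw [add_right_comm, Nat.div_add_mod'] at hsum
  rw [hsum]
  exact hB.apply_eq_one _ ha

theorem IsSeeded.isConcatenationOf (hf : IsSeeded p h k β f) (hp3 : 3 ≤ p) (hk : 1 ≤ k)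
    (hβ : β < h) (hℓ : IsGapSequence f ℓ) :
    IsConcatenationOf {[2 * p ^ h] ++ List.replicate (p ^ k - 2) (p ^ h),
      [2 * p ^ h - p ^ β] ++ List.replicate (p ^ k - 2) (p ^ h)} ℓ := by
  have hp : p.Prime := Fact.out
  have hr : 2 ≤ p ^ k := hp.two_le.trans (Nat.le_self_pow (by omega) p)
  refine isConcatenationOf_of_forall_block (M := p ^ k - 1) (by omega) fun n => ?_
  have hB := hf.isBlock hp3 hk hβ hℓ n
  have htail : (List.range (p ^ k - 1)).map (fun v => ℓ (n * (p ^ k - 1) + v)) =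
      [ℓ (n * (p ^ k - 1))] ++ List.replicate (p ^ k - 2) (p ^ h) := by
    rw [show p ^ k - 1 = p ^ k - 2 + 1 by omega, List.range_succ_eq_map, List.map_cons,
      List.map_map, List.singleton_append, ← show p ^ k - 1 = p ^ k - 2 + 1 by omega, add_zero]
    refine congrArg _ (List.eq_replicate_iff.mpr ⟨by simp, fun b hb => ?_⟩)
    obtain ⟨v, hv, rfl⟩ := List.mem_map.mp hb
    have hv : v < p ^ k - 2 := List.mem_range.mp hv
    rw [Function.comp_apply, Nat.succ_eq_one_add, ← add_assoc]
    exact (hf.isSparse.apply_gapSequence_of_isBlock (pow_pos hp.pos h) hℓ hB (by omega)).2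
      (by omega)
  rw [htail]
  rcases hB.gap_mem with hm | hm
  · exact Or.inl (by rw [hm])
  · exact Or.inr (by rw [← hm, Nat.add_sub_cancel]; rfl)

end GapSequence

section LieSequence

variable {K M : Type*} [LieRing M] {v : ℕ → M} {z : M} {f : ℕ → K}

theorem lie_eq_fwdDiff_smul [CommRing K] [LieAlgebra K M] (hz : ∀ i, 1 ≤ i → ⁅v i, z⁆ = v (i + 1))
    (hv : ∀ i, 1 ≤ i → ⁅v i, v 1⁆ = f i • v (i + 1)) (k : ℕ) {j : ℕ} (hj : 1 ≤ j) :
    ⁅v j, v (k + 1)⁆ = ((-1) ^ k * (fwdDiff 1)^[k] f j) • v (j + k + 1) := by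
  induction k generalizing j with
  | zero => simpa using hv j hj
  | succ k ih =>
    rw [← hz (k + 1) (by omega), leibniz_lie, ih hj, smul_lie, hz _ (by omega), hz j hj,
      ← lie_skew, ih (by omega), Function.iterate_succ_apply', fwdDiff, ← sub_eq_add_neg,
      show j + 1 + k + 1 = j + k + 1 + 1 by omega, ← add_assoc, ← sub_smul]
    congr 1
    ring

theorem jacobiRel_of_lie [Field K] [LieAlgebra K M] (hv0 : ∀ i, 1 ≤ i → v i ≠ 0)
    (hz : ∀ i, 1 ≤ i → ⁅v i, z⁆ = v (i + 1)) (hv : ∀ i, 1 ≤ i → ⁅v i, v 1⁆ = f i • v (i + 1)) :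
    JacobiRel f := by
  intro k j hj
  have hlie := fun k {j : ℕ} (hj : 1 ≤ j) => lie_eq_fwdDiff_smul hz hv k hj
  have hleib := leibniz_lie (v j) (v (k + 1)) (v 1)
  rw [hv _ (by omega), hv j hj, lie_smul, lie_smul, hlie (k + 1) hj, hlie k hj, smul_lie,
    hv _ (by omega), ← lie_skew, hlie k (show 1 ≤ j + 1 by omega),
    show j + (k + 1) + 1 = j + k + 1 + 1 by omega, show j + 1 + k + 1 = j + k + 1 + 1 by omega,
    smul_smul, smul_smul, smul_neg, smul_smul, ← sub_eq_add_neg, ← sub_smul] at hleib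
  have hcoef := smul_left_injective K (hv0 _ (by omega)) hleib
  rw [Function.iterate_succ_apply', fwdDiff] at hcoef
  rw [show k + 1 + j = j + k + 1 by omega]
  refine mul_left_cancel₀ (pow_ne_zero k (neg_ne_zero.mpr (one_ne_zero' K))) ?_
  linear_combination -hcoef

end LieSequence

open TensorProduct LieAlgebra

variable {F L : Type*} [Field F] [LieRing L] [LieAlgebra F L]

section GenericElement

variable {K : Type*} [CommRing K] [Algebra F K]

theorem lie_tmul_eq_of_smul_eq {u a w : L} {t : F} (ht : t • w = ⁅u, a⁆) (g c : K) :
    ⁅g ⊗ₜ[F] u, c ⊗ₜ[F] a⁆ = (g * (c * algebraMap F K t)) ⊗ₜ[F] w := by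
  rw [ExtendScalars.bracket_tmul, ← ht, TensorProduct.tmul_smul, TensorProduct.smul_tmul',
    Algebra.smul_def, mul_comm, mul_assoc]

/-- Repeated brackets `[ξ y, z, …, z]` with `i - 1` factors `z = x + ξ y`, over an extension ring
containing `ξ`. -/
noncomputable def genericSeq (x y : L) (ξ : K) (i : ℕ) : K ⊗[F] L :=
  (fun v => ⁅v, (1 : K) ⊗ₜ[F] x + ξ ⊗ₜ[F] y⁆)^[i - 1] (ξ ⊗ₜ[F] y)

theorem lie_genericSeq (x y : L) (ξ : K) {i : ℕ} (hi : 1 ≤ i) :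
    ⁅genericSeq (F := F) x y ξ i, (1 : K) ⊗ₜ[F] x + ξ ⊗ₜ[F] y⁆ = genericSeq x y ξ (i + 1) := by
  obtain ⟨i, rfl⟩ := Nat.exists_eq_add_of_le' hi
  rw [genericSeq, genericSeq, Nat.add_sub_cancel, Nat.add_sub_cancel,
    Function.iterate_succ_apply']

end GenericElement

namespace IsMaximalClass

variable {𝒜 : ℕ → Submodule F L}

theorem finite_component (hL : IsMaximalClass 𝒜) (i : ℕ) : Module.Finite F (𝒜 i) := by
  rcases i with _ | _ | i
  · rw [hL.zero_eq_bot]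
    infer_instance
  · exact Module.finite_of_rank_eq_nat (n := 2) (by simpa using hL.rank_one)
  · rw [← Module.rank_lt_aleph0_iff]
    exact (hL.rank_le_one (i + 2) (by omega)).trans_lt Cardinal.one_lt_aleph0

theorem eq_bot_of_forall_lie_eq_zero (hL : IsMaximalClass 𝒜) {i : ℕ} (hi : 1 ≤ i)
    (hlie : ∀ a ∈ 𝒜 i, ∀ b ∈ 𝒜 1, ⁅a, b⁆ = 0) : 𝒜 (i + 1) = ⊥ := by
  rw [← hL.span_lie i hi, Submodule.span_eq_bot]
  rintro c ⟨a, ha, b, hb, rfl⟩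
  exact hlie a ha b hb

theorem ne_bot (hL : IsMaximalClass 𝒜) (hinf : ¬ Module.Finite F L) {i : ℕ} (hi : 1 ≤ i) :
    𝒜 i ≠ ⊥ := by
  intro hbot
  have hzero : ∀ n, i ≤ n → 𝒜 n = ⊥ := fun n hn => by
    induction n, hn using Nat.le_induction with
    | base => exact hbot
    | succ n hn ih =>
      refine hL.eq_bot_of_forall_lie_eq_zero (by omega) fun a ha b _ => ?_
      rw [ih, Submodule.mem_bot] at ha
      rw [ha, zero_lie]
  have htop : (⨆ n : Fin i, 𝒜 n) = ⊤ := by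
    rw [eq_top_iff, ← hL.isInternal.submodule_iSup_eq_top]
    refine iSup_le fun n => ?_
    rcases Nat.lt_or_ge n i with hn | hn
    · exact le_iSup (fun n : Fin i => 𝒜 n) ⟨n, hn⟩
    · rw [hzero n hn]
      exact bot_le
  have := hL.finite_component
  have hfin : Module.Finite F (⨆ n : Fin i, 𝒜 n : Submodule F L) := inferInstance
  rw [htop] at hfin
  exact hinf (Module.Finite.equiv Submodule.topEquiv)

theorem eq_span_singleton (hL : IsMaximalClass 𝒜) {i : ℕ} (hi : 2 ≤ i) {u : L} (hu : u ∈ 𝒜 i)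
    (hu0 : u ≠ 0) : 𝒜 i = Submodule.span F {u} := by
  have := hL.finite_component i
  refine (Submodule.eq_of_le_of_finrank_le ?_ ?_).symm
  · rwa [Submodule.span_singleton_le_iff_mem]
  · rw [finrank_span_singleton hu0]
    exact Module.finrank_le_of_rank_le (by simpa using hL.rank_le_one i hi)

theorem finrank_one (hL : IsMaximalClass 𝒜) : Module.finrank F (𝒜 1) = 2 :=
  Module.finrank_eq_of_rank_eq hL.rank_one

theorem span_pair_eq (hL : IsMaximalClass 𝒜) {x y : L} (hx : x ∈ 𝒜 1) (hy : y ∈ 𝒜 1)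
    (hxy : LinearIndependent F ![x, y]) : Submodule.span F {x, y} = 𝒜 1 := by
  have := hL.finite_component 1
  refine Submodule.eq_of_le_of_finrank_eq ?_ ?_
  · rw [Submodule.span_le, Set.pair_subset_iff]
    exact ⟨hx, hy⟩
  · have hfinrank := finrank_span_eq_card hxy
    rw [Matrix.range_cons_cons_empty, Fintype.card_fin] at hfinrank
    rw [hfinrank, hL.finrank_one]

theorem exists_lie_ne_zero (hL : IsMaximalClass 𝒜) (hinf : ¬ Module.Finite F L) {i : ℕ}
    (hi : 1 ≤ i) {u : L} (hu : u ∈ 𝒜 i) (hu0 : u ≠ 0) : ∃ a ∈ 𝒜 1, ⁅u, a⁆ ≠ 0 := by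
  by_contra! hzero
  refine hL.ne_bot hinf (Nat.succ_pos i) (hL.eq_bot_of_forall_lie_eq_zero hi fun b hb a ha => ?_)
  rcases hi.eq_or_lt with rfl | hi
  · by_cases hub : LinearIndependent F ![u, b]
    · obtain ⟨s, t, rfl⟩ := Submodule.mem_span_pair.mp (hL.span_pair_eq hu hb hub ▸ ha)
      rw [lie_add, lie_smul, lie_smul, lie_self, ← lie_skew, hzero b hb]
      simp
    · rw [LinearIndependent.pair_iff' hu0] at hub
      push Not at hub
      obtain ⟨t, rfl⟩ := hub
      rw [smul_lie, hzero a ha, smul_zero]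
  · rw [hL.eq_span_singleton hi hu hu0] at hb
    obtain ⟨t, rfl⟩ := Submodule.mem_span_singleton.mp hb
    rw [smul_lie, hzero a ha, smul_zero]

theorem finrank_inf_ker_ad (hL : IsMaximalClass 𝒜) (hinf : ¬ Module.Finite F L) {i : ℕ}
    (hi : 1 ≤ i) {u : L} (hu : u ∈ 𝒜 i) (hu0 : u ≠ 0) :
    Module.finrank F ↥(𝒜 1 ⊓ LinearMap.ker (ad F L u : L →ₗ[F] L)) = 1 := by
  have := hL.finite_component
  have hne : (𝒜 1).map (ad F L u : L →ₗ[F] L) ≠ ⊥ := fun hbot => by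
    obtain ⟨a, ha, hua⟩ := hL.exists_lie_ne_zero hinf hi hu hu0
    exact hua ((Submodule.mem_bot F).mp (hbot ▸ Submodule.mem_map_of_mem ha))
  have hle : (𝒜 1).map (ad F L u : L →ₗ[F] L) ≤ 𝒜 (i + 1) :=
    Submodule.map_le_iff_le_comap.mpr fun a ha => hL.lie_mem i 1 u hu a ha
  have hrange : Module.finrank F ((𝒜 1).map (ad F L u : L →ₗ[F] L)) = 1 := by
    refine le_antisymm ((Submodule.finrank_mono hle).trans ?_)
      (Submodule.one_le_finrank_iff.mpr hne)
    exact Module.finrank_le_of_rank_le (by simpa using hL.rank_le_one (i + 1) (by omega))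
  have hrank := ((ad F L u : L →ₗ[F] L).domRestrict (𝒜 1)).finrank_range_add_finrank_ker
  rw [LinearMap.range_domRestrict, hrange, hL.finrank_one, LinearMap.ker_domRestrict,
    ← Submodule.finrank_map_subtype_eq, Submodule.map_comap_subtype] at hrank
  omega

theorem twoStepCentralizer_eq_inf_ker_ad (hL : IsMaximalClass 𝒜) {i : ℕ} (hi : 2 ≤ i) {u : L}
    (hu : u ∈ 𝒜 i) (hu0 : u ≠ 0) :
    twoStepCentralizer 𝒜 i = 𝒜 1 ⊓ LinearMap.ker (ad F L u : L →ₗ[F] L) := by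
  ext a
  refine ⟨fun ha => ⟨ha.1, ha.2 u hu⟩, fun ha => ⟨ha.1, fun b hb => ?_⟩⟩
  rw [hL.eq_span_singleton hi hu hu0] at hb
  obtain ⟨t, rfl⟩ := Submodule.mem_span_singleton.mp hb
  rw [smul_lie, show ⁅u, a⁆ = 0 from ha.2, smul_zero]

theorem finrank_twoStepCentralizer (hL : IsMaximalClass 𝒜) (hinf : ¬ Module.Finite F L) {i : ℕ}
    (hi : 2 ≤ i) : Module.finrank F (twoStepCentralizer 𝒜 i) = 1 := by
  obtain ⟨u, hu, hu0⟩ := Submodule.exists_mem_ne_zero_of_ne_bot (hL.ne_bot hinf (by omega : 1 ≤ i))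
  rw [hL.twoStepCentralizer_eq_inf_ker_ad hi hu hu0, hL.finrank_inf_ker_ad hinf (by omega) hu hu0]

theorem twoStepCentralizer_ne_bot (hL : IsMaximalClass 𝒜) (hinf : ¬ Module.Finite F L) {i : ℕ}
    (hi : 2 ≤ i) : twoStepCentralizer 𝒜 i ≠ ⊥ := fun hbot => by
  have hfinrank := hL.finrank_twoStepCentralizer hinf hi
  rw [hbot, finrank_bot] at hfinrank
  omega

theorem twoStepCentralizer_eq_span_singleton (hL : IsMaximalClass 𝒜) (hinf : ¬ Module.Finite F L)
    {i : ℕ} (hi : 2 ≤ i) {a : L} (ha : a ∈ twoStepCentralizer 𝒜 i) (ha0 : a ≠ 0) :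
    twoStepCentralizer 𝒜 i = Submodule.span F {a} := by
  have hfinrank := hL.finrank_twoStepCentralizer hinf hi
  have := Module.finite_of_finrank_pos (hfinrank.symm ▸ Nat.one_pos)
  refine (Submodule.eq_of_le_of_finrank_eq ?_ ?_).symm
  · rwa [Submodule.span_singleton_le_iff_mem]
  · rw [hfinrank, finrank_span_singleton ha0]

theorem linearIndependent_of_mem_twoStepCentralizer (hL : IsMaximalClass 𝒜)
    (hinf : ¬ Module.Finite F L) {m n : ℕ} (hm : 2 ≤ m) (hn : 2 ≤ n)
    (hne : twoStepCentralizer 𝒜 m ≠ twoStepCentralizer 𝒜 n) {x y : L}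
    (hx : x ∈ twoStepCentralizer 𝒜 m) (hx0 : x ≠ 0) (hy : y ∈ twoStepCentralizer 𝒜 n)
    (hy0 : y ≠ 0) : LinearIndependent F ![x, y] := by
  rw [LinearIndependent.pair_iff' hx0]
  rintro t rfl
  exact hne ((hL.twoStepCentralizer_eq_span_singleton hinf hm (Submodule.smul_mem _ t hx)
    hy0).trans (hL.twoStepCentralizer_eq_span_singleton hinf hn hy hy0).symm)

theorem lie_eq_zero_iff (hL : IsMaximalClass 𝒜) (hinf : ¬ Module.Finite F L) {m n : ℕ}
    (hm : 2 ≤ m) (hn : 2 ≤ n) {u a : L} (hu : u ∈ 𝒜 m) (hu0 : u ≠ 0)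
    (ha : a ∈ twoStepCentralizer 𝒜 n) (ha0 : a ≠ 0) :
    ⁅u, a⁆ = 0 ↔ twoStepCentralizer 𝒜 m = twoStepCentralizer 𝒜 n := by
  refine ⟨fun hua => ?_, fun heq => (heq ▸ ha).2 u hu⟩
  have ham : a ∈ twoStepCentralizer 𝒜 m := by
    rw [hL.twoStepCentralizer_eq_inf_ker_ad hm hu hu0]
    exact ⟨ha.1, hua⟩
  rw [hL.twoStepCentralizer_eq_span_singleton hinf hm ham ha0,
    hL.twoStepCentralizer_eq_span_singleton hinf hn ha ha0]

theorem lie_ne_zero_or_of_span_pair_eq (hL : IsMaximalClass 𝒜) (hinf : ¬ Module.Finite F L)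
    {x y : L} (hxy : Submodule.span F {x, y} = 𝒜 1) {i : ℕ} (hi : 1 ≤ i) {u : L} (hu : u ∈ 𝒜 i)
    (hu0 : u ≠ 0) : ⁅u, x⁆ ≠ 0 ∨ ⁅u, y⁆ ≠ 0 := by
  by_contra! hzero
  obtain ⟨a, ha, hua⟩ := hL.exists_lie_ne_zero hinf hi hu hu0
  obtain ⟨s, t, rfl⟩ := Submodule.mem_span_pair.mp (hxy ▸ ha)
  exact hua (by simp [hzero])

section BaseChange

variable {K : Type*} [Field K] [Algebra F K]

theorem exists_generic_lie (hL : IsMaximalClass 𝒜) (hinf : ¬ Module.Finite F L) {x y : L}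
    (hxy : Submodule.span F {x, y} = 𝒜 1) {ξ : K} (hξ : ξ ∉ Set.range (algebraMap F K))
    {i : ℕ} (hi : 1 ≤ i) {u : L} (hu : u ∈ 𝒜 i) (hu0 : u ≠ 0) :
    ∃ w ∈ 𝒜 (i + 1), w ≠ 0 ∧ ∃ c d : K, c ≠ 0 ∧
      (∀ g : K, ⁅g ⊗ₜ[F] u, (1 : K) ⊗ₜ[F] x + ξ ⊗ₜ[F] y⁆ = (g * c) ⊗ₜ[F] w) ∧
      (∀ g : K, ⁅g ⊗ₜ[F] u, ξ ⊗ₜ[F] y⁆ = (g * d) ⊗ₜ[F] w) ∧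
      (d = 0 ↔ ⁅u, y⁆ = 0) ∧ (d = c ↔ ⁅u, x⁆ = 0) := by
  obtain ⟨w, hw, hw0⟩ := Submodule.exists_mem_ne_zero_of_ne_bot (hL.ne_bot hinf (Nat.succ_pos i))
  have hspan := hL.eq_span_singleton (by omega) hw hw0
  have hmem : ∀ a ∈ 𝒜 1, ∃ t : F, t • w = ⁅u, a⁆ := fun a ha =>
    Submodule.mem_span_singleton.mp (hspan ▸ hL.lie_mem i 1 u hu a ha)
  have hx1 : x ∈ 𝒜 1 := hxy ▸ Submodule.subset_span (by simp)
  have hy1 : y ∈ 𝒜 1 := hxy ▸ Submodule.subset_span (by simp)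
  obtain ⟨s, hs⟩ := hmem x hx1
  obtain ⟨t, ht⟩ := hmem y hy1
  have hst : s ≠ 0 ∨ t ≠ 0 := by
    have := hL.lie_ne_zero_or_of_span_pair_eq hinf hxy hi hu hu0
    rw [← hs, ← ht] at this
    exact this.imp (left_ne_zero_of_smul ·) (left_ne_zero_of_smul ·)
  have hξ0 : ξ ≠ 0 := by
    rintro rfl
    exact hξ ⟨0, map_zero _⟩
  refine ⟨w, hw, hw0, algebraMap F K s + ξ * algebraMap F K t, ξ * algebraMap F K t, ?_,
    fun g => ?_, fun g => ?_, ?_, ?_⟩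
  · intro hc
    rcases eq_or_ne t 0 with rfl | ht0
    · simp_all
    · refine hξ ⟨-s / t, ?_⟩
      have ht0' : algebraMap F K t ≠ 0 := by simpa using ht0
      rw [map_div₀, map_neg, div_eq_iff ht0']
      linear_combination -hc
  · rw [lie_add, lie_tmul_eq_of_smul_eq hs, lie_tmul_eq_of_smul_eq ht,
      ← TensorProduct.add_tmul, one_mul, mul_add]
  · exact lie_tmul_eq_of_smul_eq ht g ξ
  · rw [← ht]
    simp [hξ0, hw0]
  · rw [← hs]
    simp [hw0]

theorem exists_genericSeq_eq_tmul (hL : IsMaximalClass 𝒜) (hinf : ¬ Module.Finite F L) {x y : L}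
    (hxy : Submodule.span F {x, y} = 𝒜 1) (hy0 : y ≠ 0) {ξ : K}
    (hξ : ξ ∉ Set.range (algebraMap F K)) {i : ℕ} (hi : 1 ≤ i) :
    ∃ g : K, g ≠ 0 ∧ ∃ u ∈ 𝒜 i, u ≠ 0 ∧ genericSeq x y ξ i = g ⊗ₜ[F] u := by
  induction i, hi using Nat.le_induction with
  | base =>
    refine ⟨ξ, ?_, y, hxy ▸ Submodule.subset_span (by simp), hy0, rfl⟩
    rintro rfl
    exact hξ ⟨0, map_zero _⟩
  | succ i hi ih =>
    obtain ⟨g, hg, u, hu, hu0, hv⟩ := ih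
    obtain ⟨w, hw, hw0, c, -, hc, hz, -⟩ := hL.exists_generic_lie hinf hxy hξ hi hu hu0
    exact ⟨g * c, mul_ne_zero hg hc, w, hw, hw0, by rw [← lie_genericSeq x y ξ hi, hv, hz]⟩

theorem genericSeq_ne_zero (hL : IsMaximalClass 𝒜) (hinf : ¬ Module.Finite F L) {x y : L}
    (hxy : Submodule.span F {x, y} = 𝒜 1) (hy0 : y ≠ 0) {ξ : K}
    (hξ : ξ ∉ Set.range (algebraMap F K)) {i : ℕ} (hi : 1 ≤ i) :
    genericSeq (F := F) x y ξ i ≠ 0 := by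
  obtain ⟨g, hg, u, -, hu0, hv⟩ := hL.exists_genericSeq_eq_tmul hinf hxy hy0 hξ hi
  rw [hv, ← mul_one g, ← smul_eq_mul, ← TensorProduct.smul_tmul']
  exact smul_ne_zero hg ((Module.FaithfullyFlat.one_tmul_eq_zero_iff F L u).not.mpr hu0)

theorem exists_lie_genericSeq_one (hL : IsMaximalClass 𝒜) (hinf : ¬ Module.Finite F L) {x y : L}
    (hxy : Submodule.span F {x, y} = 𝒜 1) (hy0 : y ≠ 0) {ξ : K}
    (hξ : ξ ∉ Set.range (algebraMap F K)) {i : ℕ} (hi : 1 ≤ i) :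
    ∃ f : K, ⁅genericSeq (F := F) x y ξ i, genericSeq x y ξ 1⁆ =
        f • genericSeq (F := F) x y ξ (i + 1) ∧
      ∃ u ∈ 𝒜 i, u ≠ 0 ∧ (f = 0 ↔ ⁅u, y⁆ = 0) ∧ (f = 1 ↔ ⁅u, x⁆ = 0) := by
  obtain ⟨g, -, u, hu, hu0, hv⟩ := hL.exists_genericSeq_eq_tmul hinf hxy hy0 hξ hi
  obtain ⟨w, -, -, c, d, hc, hz, hd, hd0, hdc⟩ := hL.exists_generic_lie hinf hxy hξ hi hu hu0
  refine ⟨d / c, ?_, u, hu, hu0, ?_, ?_⟩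
  · rw [← lie_genericSeq x y ξ hi, hv, hz, show genericSeq x y ξ 1 = ξ ⊗ₜ[F] y from rfl, hd,
      TensorProduct.smul_tmul', smul_eq_mul]
    congr 1
    field_simp
  · rw [← hd0, div_eq_zero_iff, or_iff_left hc]
  · rw [← hdc, div_eq_one_iff_eq hc]

theorem exists_jacobiRel (hL : IsMaximalClass 𝒜) (hinf : ¬ Module.Finite F L) {ξ : K}
    (hξ : ξ ∉ Set.range (algebraMap F K)) {N : ℕ} (hN : IsConstituentEnd 𝒜 N) :
    ∃ f : ℕ → K, JacobiRel f ∧ (∀ i, 1 ≤ i → (f i ≠ 0 ↔ IsConstituentEnd 𝒜 i)) ∧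
      ∀ i, 2 ≤ i → (f i = 1 ↔ twoStepCentralizer 𝒜 i = twoStepCentralizer 𝒜 N) := by
  obtain ⟨y, hy, hy0⟩ := Submodule.exists_mem_ne_zero_of_ne_bot
    (hL.twoStepCentralizer_ne_bot hinf le_rfl)
  obtain ⟨x, hx, hx0⟩ := Submodule.exists_mem_ne_zero_of_ne_bot
    (hL.twoStepCentralizer_ne_bot hinf hN.1)
  have hxy := hL.span_pair_eq hx.1 hy.1
    (hL.linearIndependent_of_mem_twoStepCentralizer hinf hN.1 le_rfl hN.2 hx hx0 hy hy0)
  have hv0 : ∀ i, 1 ≤ i → genericSeq (F := F) x y ξ i ≠ 0 := fun i hi =>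
    hL.genericSeq_ne_zero hinf hxy hy0 hξ hi
  have hex : ∀ i, ∃ f : K, 1 ≤ i →
      ⁅genericSeq (F := F) x y ξ i, genericSeq x y ξ 1⁆ = f • genericSeq x y ξ (i + 1) ∧
        ∃ u ∈ 𝒜 i, u ≠ 0 ∧ (f = 0 ↔ ⁅u, y⁆ = 0) ∧ (f = 1 ↔ ⁅u, x⁆ = 0) := fun i => by
    by_cases hi : 1 ≤ i
    · obtain ⟨f, hf⟩ := hL.exists_lie_genericSeq_one hinf hxy hy0 hξ hi
      exact ⟨f, fun _ => hf⟩
    · exact ⟨0, fun h => absurd h hi⟩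
  choose f hf using hex
  refine ⟨f, jacobiRel_of_lie hv0 (fun i hi => lie_genericSeq x y ξ hi) fun i hi => (hf i hi).1,
    fun i hi => ?_, fun i hi => ?_⟩
  · rcases hi.eq_or_lt with rfl | hi
    · have h1 := (hf 1 le_rfl).1
      rw [lie_self, eq_comm, smul_eq_zero, or_iff_left (hv0 2 one_le_two)] at h1
      simp [h1, IsConstituentEnd]
    · obtain ⟨u, hu, hu0, hf0, -⟩ := (hf i hi.le).2
      rw [Ne, hf0, hL.lie_eq_zero_iff hinf hi le_rfl hu hu0 hy hy0]
      exact (and_iff_right hi).symm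
  · obtain ⟨u, hu, hu0, -, hf1⟩ := (hf i (by omega)).2
    rw [hf1, hL.lie_eq_zero_iff hinf hi hN.1 hu hu0 hx hx0]

end BaseChange

end IsMaximalClass

section Constituents

variable {F L : Type*} [Field F] [LieRing L] [LieAlgebra F L] {𝒜 : ℕ → Submodule F L}

theorem JacobiRel.infinite_setOf_isConstituentEnd {R : Type*} [CommRing R] [IsDomain R] {f : ℕ → R}
    (hf : JacobiRel f) (hend : ∀ i, 1 ≤ i → (f i ≠ 0 ↔ IsConstituentEnd 𝒜 i)) {N : ℕ}
    (hN : IsConstituentEnd 𝒜 N) : {n | IsConstituentEnd 𝒜 n}.Infinite := by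
  have hN1 : 1 ≤ N := one_le_two.trans hN.1
  have hfN : f N ≠ 0 := (hend N hN1).mpr hN
  obtain ⟨m, -, hm⟩ := exists_isGap (j := 0) hN1 (by rwa [zero_add])
  refine Set.infinite_of_forall_exists_gt fun a => ?_
  suffices ∃ b, a < b ∧ f b ≠ 0 from
    this.imp fun b hb => ⟨(hend b (by omega)).mp hb.2, hb.1⟩
  induction a with
  | zero => exact ⟨N, hN1, hfN⟩
  | succ a ih =>
    obtain ⟨b, hab, hfb⟩ := ih
    obtain ⟨m', -, hm'⟩ := hf.exists_gap_le hm (by omega) hfb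
    exact ⟨b + m', by have := hm'.pos; omega, hm'.ne_zero⟩

theorem isConstituentEnd_constituentEnd_of_ne_zero {t : ℕ} (ht : constituentEnd 𝒜 t ≠ 0) :
    IsConstituentEnd 𝒜 (constituentEnd 𝒜 t) :=
  Nat.nth_mem_of_ne_zero ht

theorem isConstituentEnd_constituentEnd (hinf : {n | IsConstituentEnd 𝒜 n}.Infinite) (t : ℕ) :
    IsConstituentEnd 𝒜 (constituentEnd 𝒜 t) :=
  Nat.nth_mem_of_infinite hinf t

theorem constituentEnd_strictMono (hinf : {n | IsConstituentEnd 𝒜 n}.Infinite) :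
    StrictMono (constituentEnd 𝒜) :=
  Nat.nth_strictMono hinf

theorem IsConstituentEnd.exists_constituentEnd_eq {n : ℕ} (hn : IsConstituentEnd 𝒜 n) :
    ∃ t, constituentEnd 𝒜 t = n :=
  Nat.subset_range_nth (Set.mem_ofPred_eq ▸ hn)

theorem sum_constituentLength (hinf : {n | IsConstituentEnd 𝒜 n}.Infinite) (t : ℕ) :
    ∑ i ∈ range (t + 1), constituentLength 𝒜 i = constituentEnd 𝒜 t := by
  induction t with
  | zero => simp [constituentLength]
  | succ t ih =>
    rw [sum_range_succ, ih]
    exact Nat.add_sub_cancel' ((constituentEnd_strictMono hinf).monotone t.le_succ)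

theorem isGapSequence_constituentLength (hinf : {n | IsConstituentEnd 𝒜 n}.Infinite)
    {R : Type*} [Zero R] {f : ℕ → R} (hend : ∀ i, 1 ≤ i → (f i ≠ 0 ↔ IsConstituentEnd 𝒜 i)) :
    IsGapSequence f (constituentLength 𝒜) := by
  have hmem := isConstituentEnd_constituentEnd hinf
  have hmono := constituentEnd_strictMono hinf
  intro t
  have hsucc : ∑ i ∈ range t, constituentLength 𝒜 i + constituentLength 𝒜 t =
      constituentEnd 𝒜 t := by
    rw [← sum_range_succ, sum_constituentLength hinf]
  have hgt : ∀ n, IsConstituentEnd 𝒜 n → n < constituentEnd 𝒜 t →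
      n ≤ ∑ i ∈ range t, constituentLength 𝒜 i := fun n hn hlt => by
    obtain ⟨t', rfl⟩ := hn.exists_constituentEnd_eq
    obtain ⟨t, rfl⟩ := Nat.exists_eq_add_of_lt (hmono.lt_iff_lt.mp hlt)
    rw [sum_constituentLength hinf]
    exact hmono.monotone (Nat.le_add_right _ _)
  have hlt : ∑ i ∈ range t, constituentLength 𝒜 i < constituentEnd 𝒜 t := by
    rcases t with _ | t
    · exact zero_lt_two.trans_le (hmem 0).1
    · rw [sum_constituentLength hinf]
      exact hmono t.lt_succ_self
  refine ⟨by omega, ?_, fun s hs hst => by_contra fun hfs => ?_⟩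
  · rw [hsucc]
    exact (hend _ (by omega)).mpr (hmem t)
  · have := hgt _ ((hend _ (by omega)).mp hfs) (by omega)
    omega

theorem ncard_image_twoStepCentralizer {N : ℕ} (hN : IsConstituentEnd 𝒜 N)
    (hend : ∀ n, IsConstituentEnd 𝒜 n → twoStepCentralizer 𝒜 n = twoStepCentralizer 𝒜 N) :
    (twoStepCentralizer 𝒜 '' {i | 2 ≤ i}).ncard = 2 := by
  have himage : twoStepCentralizer 𝒜 '' {i | 2 ≤ i} =
      {twoStepCentralizer 𝒜 N, twoStepCentralizer 𝒜 2} := by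
    refine Set.Subset.antisymm (Set.image_subset_iff.mpr fun i hi => ?_)
      (Set.pair_subset ⟨N, hN.1, rfl⟩ ⟨2, le_refl 2, rfl⟩)
    exact (em' _).imp (fun hne => hend i ⟨hi, hne⟩) id
  rw [himage, Set.ncard_pair hN.2]

end Constituents

theorem ratFunc_X_notMem_range_algebraMap (F : Type*) [Field F] :
    (RatFunc.X : RatFunc F) ∉ Set.range (algebraMap F (RatFunc F)) := by
  rintro ⟨a, ha⟩
  exact RatFunc.transcendental_X (ha ▸ isAlgebraic_algebraMap a)

end MaxClass

theorem mainTheorem4 {F L : Type*} [Field F] [LieRing L] [LieAlgebra F L]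
    (p : ℕ) [Fact p.Prime] (hp : Odd p) [CharP F p]
    (𝒜 : ℕ → Submodule F L) (hL : MaxClass.IsMaximalClass 𝒜) (hinf : ¬ Module.Finite F L)
    (h k β q r : ℕ) (hq : q = p ^ h) (hk : 1 ≤ k) (hr : r = p ^ k) (hβ : β < h)
    (hseg : MaxClass.initialSegment (MaxClass.constituentLength 𝒜) r
      = [2 * q] ++ List.replicate (r - 2) q ++ [2 * q - p ^ β])
    (htwo : ∀ i, 2 ≤ i → i ≤ MaxClass.constituentEnd 𝒜 (r - 1) →
      MaxClass.twoStepCentralizer 𝒜 i = MaxClass.twoStepCentralizer 𝒜 2 ∨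
      MaxClass.twoStepCentralizer 𝒜 i = MaxClass.twoStepCentralizer 𝒜 (2 * q)) :
    (MaxClass.twoStepCentralizer 𝒜 '' {i | 2 ≤ i}).ncard = 2 ∧
    {n | MaxClass.IsConstituentEnd 𝒜 n}.Infinite ∧
    MaxClass.IsConcatenationOf
      {[2 * q] ++ List.replicate (r - 2) q, [2 * q - p ^ β] ++ List.replicate (r - 2) q}
      (MaxClass.constituentLength 𝒜) := by
  subst hq hr
  have hprime : p.Prime := Fact.out
  have hp3 : 3 ≤ p := hprime.two_le.lt_of_ne' (hp.ne_two_of_dvd_nat dvd_rfl)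
  have hfirst : MaxClass.constituentEnd 𝒜 0 = 2 * p ^ h :=
    (MaxClass.apply_of_initialSegment_eq hseg).1
  have hN : MaxClass.IsConstituentEnd 𝒜 (2 * p ^ h) := hfirst ▸
    MaxClass.isConstituentEnd_constituentEnd_of_ne_zero (by simp [hfirst, hprime.ne_zero])
  obtain ⟨f, hf, hend, hone⟩ := hL.exists_jacobiRel hinf
    (MaxClass.ratFunc_X_notMem_range_algebraMap F) hN
  have := charP_of_injective_algebraMap (algebraMap F (RatFunc F)).injective p
  have hinfinite := hf.infinite_setOf_isConstituentEnd hend hN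
  have hℓ := MaxClass.isGapSequence_constituentLength hinfinite hend
  have hsum := MaxClass.sum_constituentLength hinfinite
  have hseeded := MaxClass.isSeeded_of_initialSegment_eq hprime.two_le hk hf hℓ hseg fun t ht => by
    have hmem := MaxClass.isConstituentEnd_constituentEnd hinfinite t
    have hmono := (MaxClass.constituentEnd_strictMono hinfinite).monotone (Nat.le_sub_one_of_lt ht)
    rw [hsum, hone _ hmem.1]
    exact (htwo _ hmem.1 hmono).resolve_left hmem.2
  refine ⟨MaxClass.ncard_image_twoStepCentralizer hN fun n hn => ?_, hinfinite,
    hseeded.isConcatenationOf hp3 hk hβ hℓ⟩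
  obtain ⟨t, rfl⟩ := hn.exists_constituentEnd_eq
  rw [← hone _ hn.1, ← hsum]
  exact hseeded.apply_sum_gapSequence_eq_one hp3 hk hβ hℓ t
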